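/- Let $\mathbb K$ be a field of characteristic $0$, $G$ a finite group with $n=|G|$ elements, and let $r\ge 2$ and $L\ge 1$ be integers. For a commutative ring $A$ let $A[G]$ be the group algebra of functions $G\to A$ with the convolution $(\theta*\psi)(g)=\sum_{h\in G}\theta(gh^{-1})\psi(h)$, and let $\sigma_r(\theta)(g)=\theta(g)^r$. Let $x=(x_g)_{g\in G}$ be indeterminates, regarded as an input filter $g\mapsto x_g$, and let $\mathrm{Sym}_{\mathbb K}(x,d)$ be the space of homogeneous polynomials of degree $d$ in $x$. For $\theta=(\theta_1,\dots,\theta_L)\in\mathbb K[G]^L$ put $$\Phi_\theta=\sigma_r\bigl(\cdots\sigma_r(\sigma_r(x*\theta_1)*\theta_2)\cdots*\theta_{L-1}\bigr)*\theta_L\ \in\ \mathrm{Sym}_{\mathbb K}(x,r^{L-1})[G].$$ The coefficients of $\Phi_\theta$ are multihomogeneous polynomials in $(\theta_1,\dots,\theta_L)$, so that $\Phi:\theta\mapsto\Phi_\theta$ induces a rational map $$\tilde\Phi:\ \mathbb P(\mathbb K[G])^L\dashrightarrow\mathbb P\bigl(\mathrm{Sym}_{\mathbb K}(x,r^{L-1})[G]\bigr),\qquad([\theta_1],\dots,[\theta_L])\mapsto[\Phi_\theta].$$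 **Theorem.** The map $\tilde\Phi$ is generally regular: there is a nonzero polynomial $f$ in the coordinates of $\theta\in\mathbb K[G]^L$ such that, whenever all $\theta_l\neq0$ and $f(\theta)\neq 0$, one has $\Phi_\theta\ne0$ and the Jacobian of $\tilde\Phi$ at $([\theta_1],\dots,[\theta_L])$, i.e. the linear map $$\prod_{l=1}^L\mathbb K[G]/\mathbb K\theta_l\ \to\ \mathrm{Sym}_{\mathbb K}(x,r^{L-1})[G]/\mathbb K\Phi_\theta$$ of tangent spaces that is induced by the Jacobian $J_\theta\Phi$, has full rank, namely the dimension $L(n-1)$ of its source. Moreover the neuromanifold $\mathcal M_\Phi=\{\Phi_\theta\mid\theta\in\mathbb K[G]^L\}$ has dimension $L(n-1)+1$, where the dimension of a subset $S$ of a finite-dimensional vector space is that of its Zariski closure, i.e. the Krull dimension of the ring of polynomial functions restricted to $S$. -/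

import Mathlib

open scoped LinearAlgebra.Projectivization

noncomputable section

namespace PGCNN

/-! ### Group algebras and the network

A filter over `G` with values in `A` is a function `G → A`; the product of the group algebra
`A[G]` is convolution. -/

/-- Convolution `(θ ∗ ψ)(g) = ∑ h, θ(g h⁻¹) ψ(h)`, the product of the group algebra `A[G]`. -/
def conv {G A : Type*} [Group G] [Fintype G] [CommSemiring A] (θ ψ : G → A) : G → A :=
  fun g => ∑ h : G, θ (g * h⁻¹) * ψ h

/-- The activation function `σ_r`: the `r`-th Hadamard (componentwise) power. -/
def hadamardPow {G A : Type*} [CommSemiring A] (r : ℕ) (θ : G → A) : G → A :=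
  fun g => θ g ^ r

/-- The network of depth `L` and activation degree `r` with weight filters `θ 0, …, θ (L - 1)`,
applied to the input filter `x`:
`σ_r(⋯ σ_r(σ_r(x ∗ θ 0) ∗ θ 1) ⋯ ∗ θ (L - 2)) ∗ θ (L - 1)`. -/
def network {G A : Type*} [Group G] [Fintype G] [CommSemiring A] (r : ℕ) :
    (L : ℕ) → (Fin L → G → A) → (G → A) → (G → A)
  | 0, _, x => x
  | 1, θ, x => conv x (θ 0)
  | L + 2, θ, x =>
      conv (hadamardPow r (network r (L + 1) (fun l => θ l.castSucc) x)) (θ (Fin.last (L + 1)))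

section Facts

variable {G : Type*} [Group G] [Fintype G]

theorem network_map {A B : Type*} [CommSemiring A] [CommSemiring B] (f : A →+* B) (r : ℕ) :
    ∀ (L : ℕ) (θ : Fin L → G → A) (x : G → A) (g : G),
      f (network r L θ x g) = network r L (fun l h => f (θ l h)) (fun h => f (x h)) g
  | 0, _, _, _ => rfl
  | 1, _, _, _ => by simp [network, conv]
  | L + 2, θ, x, g => by
      simp [network, conv, hadamardPow, network_map f r (L + 1)]

theorem network_homogeneous {A σ : Type*} [CommSemiring A] (w : σ → ℕ) (r : ℕ) :
    ∀ (L : ℕ) (θ : Fin L → G → MvPolynomial σ A) (x : G → MvPolynomial σ A),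
      (∀ l h, (θ l h).IsWeightedHomogeneous w 0) → (∀ h, (x h).IsWeightedHomogeneous w 1) →
      ∀ g, (network r L θ x g).IsWeightedHomogeneous w (r ^ (L - 1))
  | 0, _, _, _, hx, g => by simpa [network] using hx g
  | 1, θ, x, hθ, hx, g => by
      simp only [network, conv]
      refine MvPolynomial.IsWeightedHomogeneous.sum _ _ _ fun h _ => ?_
      simpa using (hx _).mul (hθ 0 h)
  | L + 2, θ, x, hθ, hx, g => by
      simp only [network, conv, hadamardPow]
      refine MvPolynomial.IsWeightedHomogeneous.sum _ _ _ fun h _ => ?_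
      have := ((network_homogeneous w r (L + 1) (fun l => θ l.castSucc) x
        (fun l h => hθ _ h) hx (g * h⁻¹)).pow r).mul (hθ (Fin.last (L + 1)) h)
      simpa [pow_succ, mul_comm] using this

theorem network_homogeneous_param {A σ : Type*} [CommSemiring A] (w : σ → ℕ) (r : ℕ) :
    ∀ (L : ℕ) (b : Fin L → ℕ) (θ : Fin L → G → MvPolynomial σ A) (x : G → MvPolynomial σ A),
      (∀ l h, (θ l h).IsWeightedHomogeneous w (b l)) →
      (∀ h, (x h).IsWeightedHomogeneous w 0) →
      ∃ k, ∀ g, (network r L θ x g).IsWeightedHomogeneous w k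
  | 0, _, _, _, _, hx => ⟨0, fun g => by simpa [network] using hx g⟩
  | 1, b, θ, x, hθ, hx => by
      refine ⟨b 0, fun g => ?_⟩
      simp only [network, conv]
      refine MvPolynomial.IsWeightedHomogeneous.sum _ _ _ fun h _ => ?_
      simpa using (hx _).mul (hθ 0 h)
  | L + 2, b, θ, x, hθ, hx => by
      obtain ⟨k, hk⟩ := network_homogeneous_param w r (L + 1) (fun l => b l.castSucc)
        (fun l => θ l.castSucc) x (fun l h => hθ _ h) hx
      refine ⟨r • k + b (Fin.last (L + 1)), fun g => ?_⟩
      simp only [network, conv, hadamardPow]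
      exact MvPolynomial.IsWeightedHomogeneous.sum _ _ _ fun h _ =>
        ((hk (g * h⁻¹)).pow r).mul (hθ (Fin.last (L + 1)) h)

theorem network_smul {K A : Type*} [Field K] [CommRing A] [Algebra K A] (r : ℕ) :
    ∀ (L : ℕ) (a : Fin L → K) (θ : Fin L → G → A) (x : G → A), (∀ l, a l ≠ 0) →
      ∃ c : K, c ≠ 0 ∧ ∀ g, network r L (fun l h => a l • θ l h) x g = c • network r L θ x g
  | 0, _, _, _, _ => ⟨1, one_ne_zero, fun g => by simp [network]⟩
  | 1, a, θ, x, ha => ⟨a 0, ha 0, fun g => by simp [network, conv, Finset.smul_sum]⟩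
  | L + 2, a, θ, x, ha => by
      obtain ⟨c, hc, h⟩ := network_smul r (L + 1) (fun l => a l.castSucc)
        (fun l => θ l.castSucc) x (fun l => ha _)
      refine ⟨c ^ r * a (Fin.last (L + 1)), mul_ne_zero (pow_ne_zero _ hc) (ha _), fun g => ?_⟩
      simp only [network, conv, hadamardPow, h, Finset.smul_sum, smul_pow, smul_mul_smul_comm]

theorem isHomogeneous_aeval_of_weighted {A σ τ : Type*} [CommSemiring A] {w : σ → ℕ}
    {p : MvPolynomial σ A} {d : ℕ} (hp : p.IsWeightedHomogeneous w d)
    (v : σ → MvPolynomial τ A) (hv : ∀ i, (v i).IsHomogeneous (w i)) :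
    (MvPolynomial.aeval v p).IsHomogeneous d := by
  classical
  rw [MvPolynomial.aeval_def, MvPolynomial.eval₂_eq]
  refine MvPolynomial.IsHomogeneous.sum _ _ _ fun m hm => ?_
  have h2 : d = 0 + ∑ i ∈ m.support, w i * m i := by
    have := hp (MvPolynomial.mem_support_iff.mp hm)
    rw [← this, Finsupp.weight_apply, Finsupp.sum]
    simp [mul_comm]
  rw [h2]
  refine MvPolynomial.IsHomogeneous.mul (MvPolynomial.isHomogeneous_C _ _) ?_
  exact MvPolynomial.IsHomogeneous.prod _ _ _ fun i _ => (hv i).pow _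

end Facts

/-! ### The parametrization map and its Jacobian -/

section Parametrization

variable (K G : Type*) [Field K] [Group G] [Fintype G]

/-- `Sym_K(x, d)[G]`, where `x = (x_g)_{g ∈ G}`: filters whose values are homogeneous polynomials
of degree `d` in the variables `x`. -/
abbrev SymFilter (d : ℕ) : Type _ := G → MvPolynomial.homogeneousSubmodule G K d

variable {K G}

/-- The Hadamard parametrization `Φ : K[G]^L → Sym_K(x, r^{L-1})[G]`, `θ ↦ Φ_θ`: the network with
weight filters `θ`, evaluated at the generic input filter `x = (x_g)_{g ∈ G}`. -/
def Phi (r L : ℕ) (θ : Fin L → G → K) : SymFilter K G (r ^ (L - 1)) := fun g =>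
  ⟨network r L (fun l h => MvPolynomial.C (θ l h)) (fun h => MvPolynomial.X h) g,
    network_homogeneous 1 r L _ _
      (fun _ _ => MvPolynomial.isWeightedHomogeneous_C _ _)
      (fun h => MvPolynomial.isWeightedHomogeneous_X _ _ h) g⟩

/-- The neuromanifold `M_Φ`: the image of `Φ`. -/
def neuromanifold (K G : Type*) [Field K] [Group G] [Fintype G] (r L : ℕ) :
    Set (SymFilter K G (r ^ (L - 1))) :=
  Set.range (Phi r L)

/-- The symbolic network: `Φ_θ(g)` as a polynomial in the input variables `x_h` (`Sum.inl h`) and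
in the weight parameters `θ_l(h)` (`Sum.inr (l, h)`) together. -/
def symbolicPhi (K : Type*) {G : Type*} [Field K] [Group G] [Fintype G] (r L : ℕ) (g : G) :
    MvPolynomial (G ⊕ (Fin L × G)) K :=
  network r L (fun l h => MvPolynomial.X (Sum.inr (l, h))) (fun h => MvPolynomial.X (Sum.inl h)) g

/-- Substitute the numbers `θ_l(h)` for the weight parameters and keep the input variables. -/
def specialize {L : ℕ} (θ : Fin L → G → K) : G ⊕ (Fin L × G) → MvPolynomial G K :=
  Sum.elim MvPolynomial.X (fun i => MvPolynomial.C (θ i.1 i.2))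

theorem aeval_symbolicPhi (r L : ℕ) (θ : Fin L → G → K) (g : G) :
    MvPolynomial.aeval (specialize θ) (symbolicPhi K r L g) = (Phi r L θ g).1 := by
  have := network_map ((MvPolynomial.aeval (R := K) (specialize θ)).toRingHom) r L
    (fun l h => MvPolynomial.X (Sum.inr (l, h)) : Fin L → G → MvPolynomial (G ⊕ (Fin L × G)) K)
    (fun h => MvPolynomial.X (Sum.inl h)) g
  simpa [symbolicPhi, Phi, specialize] using this

/-- The column of the Jacobian matrix `J_θ Φ` that belongs to the parameter `θ_l(h)`: the partial
derivative `∂Φ_θ / ∂θ_l(h)` (taken coefficientwise in `x`) at the point `θ`. -/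
def partialPhi (r L : ℕ) (θ : Fin L → G → K) (i : Fin L × G) :
    SymFilter K G (r ^ (L - 1)) := fun g =>
  ⟨MvPolynomial.aeval (specialize θ)
      (MvPolynomial.pderiv (Sum.inr i) (symbolicPhi K r L g)), by
    have h : (symbolicPhi K r L g).IsWeightedHomogeneous
        (Sum.elim 1 0 : G ⊕ (Fin L × G) → ℕ) (r ^ (L - 1)) :=
      network_homogeneous _ r L _ _
        (fun l h => MvPolynomial.isWeightedHomogeneous_X _ _ (Sum.inr (l, h)))
        (fun h => MvPolynomial.isWeightedHomogeneous_X _ _ (Sum.inl h)) g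
    refine isHomogeneous_aeval_of_weighted (h.pderiv (i := Sum.inr i) (by simp)) _ ?_
    rintro (j | j)
    · exact MvPolynomial.isHomogeneous_X _ _
    · exact MvPolynomial.isHomogeneous_C _ _⟩

/-- The Jacobian `J_θ Φ`, as a linear map on perturbations `θ' ∈ K[G]^L`. -/
def jacobianPhi (r L : ℕ) (θ : Fin L → G → K) :
    (Fin L → G → K) →ₗ[K] SymFilter K G (r ^ (L - 1)) where
  toFun θ' := ∑ i : Fin L × G, θ' i.1 i.2 • partialPhi r L θ i
  map_add' a b := by simp [add_smul, Finset.sum_add_distrib]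
  map_smul' c a := by simp [mul_smul, Finset.smul_sum]

/-! ### The projectivized parametrization -/

theorem Phi_smul (r L : ℕ) (a : Fin L → K) (ha : ∀ l, a l ≠ 0) (θ : Fin L → G → K) :
    ∃ c : K, c ≠ 0 ∧ Phi r L (fun l => a l • θ l) = c • Phi r L θ := by
  obtain ⟨c, hc, h⟩ := network_smul (K := K) r L a
    (fun l h => (MvPolynomial.C (θ l h) : MvPolynomial G K)) MvPolynomial.X ha
  refine ⟨c, hc, funext fun g => Subtype.ext ?_⟩
  simpa [Phi, MvPolynomial.smul_eq_C_mul] using h g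

/-- The rational map `Φ̃ : P(K[G])^L ⇢ P(Sym_K(x, r^{L-1})[G])`, `[θ] ↦ [Φ_θ]`, at a point where
`Φ_θ` does not vanish. -/
def PhiTilde (r L : ℕ) (p : Fin L → ℙ K (G → K)) (hp : Phi r L (fun l => (p l).rep) ≠ 0) :
    ℙ K (SymFilter K G (r ^ (L - 1))) :=
  Projectivization.mk K (Phi r L fun l => (p l).rep) hp

/-- `Φ̃` does not depend on the representatives. -/
theorem PhiTilde_mk (r L : ℕ) (θ : Fin L → G → K) (hθ : ∀ l, θ l ≠ 0) (h : Phi r L θ ≠ 0) :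
    ∃ hp, PhiTilde r L (fun l => Projectivization.mk K (θ l) (hθ l)) hp =
      Projectivization.mk K (Phi r L θ) h := by
  choose a ha using fun l => Projectivization.exists_smul_eq_mk_rep K (θ l) (hθ l)
  obtain ⟨c, hc, e⟩ := Phi_smul r L (fun l => (a l : K)) (fun l => (a l).ne_zero) θ
  have e' : Phi r L (fun l => (Projectivization.mk K (θ l) (hθ l)).rep) = c • Phi r L θ := by
    rw [← e]
    congr 1
    funext l
    exact (ha l).symm
  refine ⟨by rw [e']; exact smul_ne_zero hc h, ?_⟩
  rw [PhiTilde, Projectivization.mk_eq_mk_iff']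
  exact ⟨c, e'.symm⟩

/-- The tangent space of `P(K[G])^L` at `p = ([θ_1], …, [θ_L])`: the product of the tangent spaces
`K[G] / K θ_l` of the factors, written as the quotient of `K[G]^L` by `∏ K θ_l`. -/
abbrev SourceTangent {L : ℕ} (p : Fin L → ℙ K (G → K)) : Type _ :=
  (Fin L → G → K) ⧸ Submodule.pi Set.univ (fun l => (p l).submodule)

theorem finrank_sourceTangent {L : ℕ} (p : Fin L → ℙ K (G → K)) :
    Module.finrank K (SourceTangent p) = L * (Fintype.card G - 1) := by
  classical
  have e := (Submodule.quotientPi fun l => (p l).submodule).finrank_eq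
  rw [e, Module.finrank_pi_fintype]
  have h : ∀ l, Module.finrank K ((G → K) ⧸ (p l).submodule) = Fintype.card G - 1 := fun l => by
    have := (p l).submodule.finrank_quotient_add_finrank
    rw [Projectivization.finrank_submodule, Module.finrank_fintype_fun_eq_card] at this
    omega
  simp [h]

/-- Euler's relation: perturbing one filter along itself moves `Φ_θ` only along itself. -/
theorem jacobianPhi_single (r L : ℕ) (θ : Fin L → G → K) (l : Fin L) :
    ∃ k : ℕ, jacobianPhi r L θ (Pi.single l (θ l)) = k • Phi r L θ := by
  classical
  let w : G ⊕ (Fin L × G) → ℕ := Sum.elim 0 (fun i => if i.1 = l then 1 else 0)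
  obtain ⟨k, hk⟩ := network_homogeneous_param (A := K) (G := G) w r L
    (fun l' => if l' = l then 1 else 0)
    (fun l h => MvPolynomial.X (Sum.inr (l, h))) (fun h => MvPolynomial.X (Sum.inl h))
    (fun l' h => MvPolynomial.isWeightedHomogeneous_X _ _ (Sum.inr (l', h)))
    (fun h => MvPolynomial.isWeightedHomogeneous_X _ _ (Sum.inl h))
  refine ⟨k, funext fun g => Subtype.ext ?_⟩
  have e := congrArg (MvPolynomial.aeval (specialize θ)) (hk g).sum_weight_X_mul_pderiv
  change _ = MvPolynomial.aeval (specialize θ) (k • symbolicPhi K r L g) at e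
  rw [map_nsmul, aeval_symbolicPhi] at e
  change _ = k • (Phi r L θ g).1
  rw [← e, Fintype.sum_sum_type]
  simp only [jacobianPhi, LinearMap.coe_mk, AddHom.coe_mk, Finset.sum_apply, Pi.smul_apply,
    Submodule.coe_sum, Submodule.coe_smul, partialPhi, map_sum, w, Sum.elim_inl,
    Sum.elim_inr, Pi.zero_apply, zero_smul, Finset.sum_const_zero, zero_add]
  refine Finset.sum_congr rfl fun i _ => ?_
  by_cases hi : i.1 = l
  · subst hi
    simp [symbolicPhi, specialize, MvPolynomial.smul_eq_C_mul]
  · simp [hi]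

theorem jacobianPhi_le (r L : ℕ) (p : Fin L → ℙ K (G → K))
    (hp : Phi r L (fun l => (p l).rep) ≠ 0) :
    Submodule.pi Set.univ (fun l => (p l).submodule) ≤
      (PhiTilde r L p hp).submodule.comap (jacobianPhi r L fun l => (p l).rep) := by
  classical
  intro v hv
  have hv' : ∀ l, ∃ c : K, c • (p l).rep = v l := fun l => by
    have : v l ∈ (p l).submodule := hv l (Set.mem_univ l)
    rwa [Projectivization.submodule_eq, Submodule.mem_span_singleton] at this
  choose c hc using hv'
  have hsum : v = ∑ l, c l • Pi.single l ((p l).rep) := by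
    funext l
    rw [Finset.sum_apply, Finset.sum_eq_single l]
    · simp [hc]
    · intro b _ hb
      simp [hb.symm]
    · simp
  rw [Submodule.mem_comap, hsum, map_sum, PhiTilde, Projectivization.submodule_mk]
  refine Submodule.sum_mem _ fun l _ => ?_
  rw [map_smul]
  obtain ⟨k, hk⟩ := jacobianPhi_single r L (fun l => (p l).rep) l
  rw [hk]
  exact Submodule.smul_mem _ _ (nsmul_mem (Submodule.mem_span_singleton_self _) k)

/-- The Jacobian (differential) of the rational map `Φ̃` at `p = ([θ_1], …, [θ_L])`, from the
tangent space `∏ K[G] / K θ_l` of the source to the tangent space `Sym_K(x, r^{L-1})[G] / K Φ_θ`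
of the target: the map induced by `J_θ Φ`. (Here `T_{[v]} P(V)` is identified with `V / K v` by
means of the representative `v`; another representative changes this by a scalar factor, which
has no influence on the rank.) -/
def jacobianPhiTilde (r L : ℕ) (p : Fin L → ℙ K (G → K))
    (hp : Phi r L (fun l => (p l).rep) ≠ 0) :
    SourceTangent p →ₗ[K] SymFilter K G (r ^ (L - 1)) ⧸ (PhiTilde r L p hp).submodule :=
  Submodule.mapQ _ _ (jacobianPhi r L fun l => (p l).rep) (jacobianPhi_le r L p hp)

/-- A condition is general on `P(K[G])^L` if it holds on a nonempty Zariski open set: there is a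
nonzero polynomial in the parameters `θ_l(h)` such that the condition holds at `[θ]` whenever the
polynomial does not vanish at `θ`. -/
def IsGeneral {L : ℕ} (P : (Fin L → ℙ K (G → K)) → Prop) : Prop :=
  ∃ f : MvPolynomial (Fin L × G) K, f ≠ 0 ∧
    ∀ (θ : Fin L → G → K) (hθ : ∀ l, θ l ≠ 0),
      MvPolynomial.eval (fun i => θ i.1 i.2) f ≠ 0 →
        P (fun l => Projectivization.mk K (θ l) (hθ l))

/-- `Φ̃` is generally regular: at a general point it is defined and its Jacobian has full rank,
the dimension of the source `P(K[G])^L`. -/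
def IsGenerallyRegular (K G : Type*) [Field K] [Group G] [Fintype G] (r L : ℕ) : Prop :=
  IsGeneral fun p : Fin L → ℙ K (G → K) =>
    ∃ hp : Phi r L (fun l => (p l).rep) ≠ 0,
      Module.finrank K (LinearMap.range (jacobianPhiTilde r L p hp)) =
        Module.finrank K (SourceTangent p)

end Parametrization

/-! ### Dimension -/

/-- The coordinate ring `K[S]` of (the Zariski closure of) a subset `S` of a finite-dimensional
vector space `W`: the polynomial functions on `W`, restricted to `S`. It is generated by the
restrictions of the linear forms, and it is the quotient of the polynomial ring of `W` by the ideal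
of the polynomials that vanish on `S`. -/
def coordinateRing (K : Type*) {W : Type*} [Field K] [AddCommGroup W] [Module K W] (S : Set W) :
    Subalgebra K (S → K) :=
  Algebra.adjoin K (Set.range fun (ℓ : Module.Dual K W) (s : S) => ℓ (s : W))

/-- The dimension of a subset `S` of a finite-dimensional vector space: the dimension of its Zariski
closure, that is, the Krull dimension of `K[S]`. -/
def zariskiDim (K : Type*) {W : Type*} [Field K] [AddCommGroup W] [Module K W] (S : Set W) :
    WithBot ℕ∞ :=
  ringKrullDim (coordinateRing K S)

end PGCNN

end

/-! ### Krull dimension and transcendence degree of finitely generated domains -/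

/-! Both claims come from one minor of the Jacobian, evaluated where every filter is the identity of
`K[G]`. There the partial derivative along `θ_l(h)`, read at `g = 1`, is the single monomial
`r^(L-1-l) x_1^(r^(L-1)-r^l) x_{h⁻¹}^(r^l)` (`partialPhi_single_one`). These monomials are distinct
over all `(l, h)` with `h ≠ 1` together with one index with `h = 1`, so a minor of size `L(n-1)+1`
is diagonal with powers of `r` on the diagonal. In characteristic `0` it is a nonzero polynomial in
`θ` (`det_testMatrix_ne_zero`).

Where the minor does not vanish, `J_θ Φ` has rank at least `L(n-1)+1`. Dividing the target by the
line `K Φ_θ` costs at most one, which leaves the full rank `L(n-1)`.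

For the dimension, the Jacobian criterion makes the corresponding `L(n-1)+1` coefficients of `Φ`
algebraically independent. Conversely, rescaling filters normalizes `θ_l(1) = 1` in all layers but
the last (`exists_Phi_normalForm_eq`), so the coordinate ring embeds in a polynomial ring in
`L(n-1)+1` variables. Noether normalization turns this squeezed transcendence degree into the Krull
dimension. -/

theorem ringKrullDim_eq_of_isIntegral_of_injective {R S : Type*} [CommRing R] [CommRing S]
    [Algebra R S] [Algebra.IsIntegral R S] (hinj : Function.Injective (algebraMap R S)) :
    ringKrullDim S = ringKrullDim R := by
  apply le_antisymm
  -- Incomparability: contraction of primes is strictly monotone along an integral extension.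
  · refine Order.krullDim_le_of_strictMono (PrimeSpectrum.comap (algebraMap R S)) fun p q h => ?_
    exact Ideal.IsIntegral.comap_lt_comap (R := R) (I := p.asIdeal) (J := q.asIdeal) h
  · refine iSup_le fun l => ?_
    -- Lying over supplies a prime above the bottom of the chain; going up then lifts the rest.
    obtain ⟨Q, -, hQ, hQ'⟩ := Ideal.exists_ideal_over_prime_of_isIntegral
      l.head.asIdeal (⊥ : Ideal S) (by
        rw [← RingHom.ker_eq_comap_bot, (RingHom.injective_iff_ker_eq_bot _).mp hinj]
        exact bot_le)
    have : Q.LiesOver l.head.asIdeal := ⟨hQ'.symm⟩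
    obtain ⟨l', h, -⟩ := Ideal.exists_ltSeries_of_hasGoingUp (S := S) l Q
    rw [← h]
    exact le_iSup (fun l : LTSeries (PrimeSpectrum S) => ((l.length : ℕ∞) : WithBot ℕ∞)) l'

theorem ringKrullDim_eq_of_algebraicIndependent_of_injective {K R ι κ : Type*} [Field K]
    [CommRing R] [Algebra K R] [Algebra.FiniteType K R] [Fintype ι] [Fintype κ]
    (hcard : Fintype.card ι = Fintype.card κ)
    {f : ι → R} (hf : AlgebraicIndependent K f)
    (g : R →ₐ[K] MvPolynomial κ K) (hg : Function.Injective g) :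
    ringKrullDim R = (Fintype.card ι : ℕ) := by
  have : IsDomain R := hg.isDomain g.toRingHom
  obtain ⟨s, φ, hφ, hint⟩ := exists_integral_inj_algHom_of_fg K R
  algebraize [φ.toRingHom]
  have hdim := ringKrullDim_eq_of_isIntegral_of_injective (R := MvPolynomial (Fin s) K) (S := R) hφ
  rw [hdim, MvPolynomial.ringKrullDim_of_isNoetherianRing, ringKrullDim_eq_zero_of_field]
  -- The Noether variables form a transcendence basis because `R` is integral over their image, so
  -- `s` is the transcendence degree, which `f` and `g` bound from below and above.
  have hbasis : IsTranscendenceBasis K (fun i => φ (MvPolynomial.X i)) := by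
    have h1 : AlgebraicIndependent K (fun i => φ (MvPolynomial.X i)) :=
      (MvPolynomial.algebraicIndependent_X (Fin s) K).map' hφ
    refine h1.isTranscendenceBasis_iff_isAlgebraic.mpr ?_
    have hr : Algebra.adjoin K (Set.range fun i => φ (MvPolynomial.X i)) = φ.range := by
      rw [← Algebra.map_top φ, ← MvPolynomial.adjoin_range_X, AlgHom.map_adjoin, ← Set.range_comp]
      rfl
    refine ⟨fun x => ?_⟩
    have hx : IsIntegral (MvPolynomial (Fin s) K) x := Algebra.IsIntegral.isIntegral x
    obtain ⟨p, hp, hpx⟩ := hx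
    let ψ : MvPolynomial (Fin s) K →+*
        Algebra.adjoin K (Set.range fun i => φ (MvPolynomial.X i)) :=
      (φ.codRestrict _ fun y => hr ▸ ⟨y, rfl⟩).toRingHom
    refine IsIntegral.isAlgebraic ⟨p.map ψ, hp.map _, ?_⟩
    rw [Polynomial.eval₂_map]
    exact hpx
  have hs : Algebra.trdeg K R = (s : Cardinal) := by
    have := hbasis.lift_cardinalMk_eq_trdeg
    simpa using this.symm
  have h1 := hf.lift_cardinalMk_le_trdeg
  have h2 := lift_trdeg_le_of_injective g hg
  rw [hs] at h1 h2
  rw [MvPolynomial.trdeg_of_isDomain] at h2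
  simp only [Cardinal.mk_fintype, Cardinal.lift_natCast, Nat.cast_le] at h1 h2
  have : s = Fintype.card ι := by omega
  simp [this]

/-! ### The Jacobian criterion for algebraic independence -/

namespace MvPolynomial

theorem eq_C_of_pderiv_eq_zero {K ι : Type*} [Field K] [CharZero K] {p : MvPolynomial ι K}
    (h : ∀ i, pderiv i p = 0) : p = C (coeff 0 p) := by
  classical
  ext m
  rw [coeff_C]
  split_ifs with hm
  · rw [hm]
  · obtain ⟨i, hi⟩ := Finsupp.ne_iff.mp (Ne.symm hm)
    obtain ⟨m', rfl⟩ : ∃ m', m = m' + Finsupp.single i 1 :=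
      ⟨m - Finsupp.single i 1, (tsub_add_cancel_of_le (Finsupp.single_le_iff.mpr
        (Nat.one_le_iff_ne_zero.mpr hi))).symm⟩
    have := congrArg (coeff m') (h i)
    rw [coeff_pderiv, coeff_zero, mul_eq_zero] at this
    exact this.resolve_right (Nat.cast_add_one_ne_zero _)

theorem pderiv_aeval {R ι τ : Type*} [CommRing R] [Fintype ι] (f : ι → MvPolynomial τ R)
    (p : MvPolynomial ι R) (j : τ) :
    pderiv j (aeval f p) = ∑ i, aeval f (pderiv i p) * pderiv j (f i) := by
  classical
  induction p using MvPolynomial.induction_on with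
  | C a => simp [algebraMap_eq]
  | add p q hp hq => simp only [map_add, hp, hq, add_mul, Finset.sum_add_distrib]
  | mul_X p k hp =>
    simp only [map_mul, aeval_X, Derivation.leibniz, hp, smul_eq_mul, map_add, add_mul,
      Finset.sum_add_distrib, pderiv_X, Pi.single_apply, Finset.mul_sum]
    congr 1
    · rw [Finset.sum_eq_single k] <;> simp +contextual [eq_comm]
    · exact Finset.sum_congr rfl fun i _ => by ring

/-- Differentiating a relation `p(f) = 0` by the chain rule shows that the vector of the `(∂_i
p)(f)` is killed by an invertible Jacobian. Each `∂_i p` is thus a relation of smaller degree, zero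
by induction; in characteristic `0` this makes `p` constant, hence zero. -/
theorem algebraicIndependent_of_det_pderiv_ne_zero {K ι τ : Type*} [Field K] [CharZero K]
    [Fintype ι] [DecidableEq ι] (f : ι → MvPolynomial τ K) (e : ι → τ)
    (h : (Matrix.of fun i j => pderiv (e j) (f i)).det ≠ 0) : AlgebraicIndependent K f := by
  have key : ∀ (N : ℕ) (p : MvPolynomial ι K), p.totalDegree ≤ N → aeval f p = 0 → p = 0 := by
    intro N
    induction N with
    | zero =>
      intro p hp h0
      rw [totalDegree_eq_zero_iff_eq_C.mp (Nat.le_zero.mp hp)] at h0 ⊢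
      simpa using h0
    | succ N ih =>
      intro p hp h0
      have hv : (fun i => aeval f (pderiv i p)) = 0 := by
        refine Matrix.eq_zero_of_vecMul_eq_zero h ?_
        ext1 j
        have := pderiv_aeval f p (e j)
        rw [h0, map_zero] at this
        exact this.symm
      have hd : ∀ i, pderiv i p = 0 := fun i => by
        refine ih _ (Finset.sup_le fun m hm => ?_) (congrFun hv i)
        rw [mem_support_iff, coeff_pderiv] at hm
        have h1 := (le_totalDegree (mem_support_iff.mpr (left_ne_zero_of_mul hm))).trans hp
        rw [Finsupp.sum_add_index' (by simp) (by simp)] at h1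
        simpa using h1
      rw [eq_C_of_pderiv_eq_zero hd] at h0 ⊢
      simpa using h0
  exact (algebraicIndependent_iff_injective_aeval).mpr
    ((injective_iff_map_eq_zero _).mpr fun p hp => key _ p le_rfl hp)

end MvPolynomial

noncomputable section

namespace PGCNN

/-! ### The network and its derivative at the identity filters -/

section IdentityFilters

variable {G : Type*} [Group G] [Fintype G] [DecidableEq G]

theorem conv_single_one {A : Type*} [CommSemiring A] (x : G → A) :
    conv x (Pi.single 1 1) = x := by
  funext g
  rw [conv, Finset.sum_eq_single 1] <;> simp +contextual

theorem network_single_one {A : Type*} [CommSemiring A] (r : ℕ) :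
    ∀ (L : ℕ) (x : G → A) (g : G),
      network r L (fun _ => Pi.single 1 1) x g = x g ^ r ^ (L - 1)
  | 0, _, _ => by simp [network]
  | 1, _, _ => by simp [network, conv_single_one]
  | L + 2, x, g => by
      simp [network, conv_single_one, hadamardPow, network_single_one r (L + 1), ← pow_mul,
        pow_succ]

/-- Here `φ` specializes the weights to the identity filters. A perturbation of layer `l` enters as
`x_{gh⁻¹}^(r^l)`, and each later activation multiplies it by `r x_g^(r^k (r-1))` for `k = l, …,
L-2`; these exponents telescope to `r^(L-1) - r^l`. -/
theorem map_derivation_network {R A B : Type*} [CommRing R] [CommRing A] [CommRing B]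
    [Algebra R A] (D : Derivation R A A) (φ : A →+* B) {r : ℕ} (hr : 0 < r) (x : G → A)
    (hx : ∀ g, D (x g) = 0) :
    ∀ (L : ℕ) (θ : Fin L → G → A), (∀ l h, φ (θ l h) = (Pi.single 1 1 : G → B) h) →
      ∀ g, φ (D (network r L θ x g)) =
        ∑ l : Fin L, ∑ h, (r : B) ^ (L - 1 - l) * φ (x g) ^ (r ^ (L - 1) - r ^ (l : ℕ)) *
          φ (x (g * h⁻¹)) ^ r ^ (l : ℕ) * φ (D (θ l h))
  | 0, _, _, g => by simp [network, hx]
  | 1, θ, _, g => by simp [network, conv, hx]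
  | L + 2, θ, hθ, g => by
      have ih := map_derivation_network D φ hr x hx (L + 1) (fun l => θ l.castSucc)
        (fun l h => hθ _ h) g
      have hN : ∀ g, φ (network r (L + 1) (fun l => θ l.castSucc) x g) = φ (x g) ^ r ^ L := by
        intro g
        rw [network_map]
        refine Eq.trans ?_ (network_single_one r (L + 1) (fun h => φ (x h)) g)
        congr 1
        funext l h
        exact hθ _ h
      rw [Fin.sum_univ_castSucc]
      simp only [network, conv, hadamardPow, map_sum, Derivation.leibniz, Derivation.leibniz_pow,
        map_add, smul_eq_mul, map_mul, map_pow, nsmul_eq_mul, map_natCast, hN, hθ,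
        Finset.sum_add_distrib]
      rw [add_comm]
      congr 1
      -- The last filter specializes to the identity, so only its value at `1` lets the derivative
      -- of the earlier layers through.
      · rw [Finset.sum_eq_single 1 (by simp +contextual) (by simp), inv_one, mul_one, ih]
        simp only [Pi.single_eq_same, one_mul, Finset.mul_sum]
        refine Finset.sum_congr rfl fun l _ => Finset.sum_congr rfl fun h _ => ?_
        have h1 : (r : B) ^ (L + 2 - 1 - (l.castSucc : ℕ)) = r * r ^ (L + 1 - 1 - (l : ℕ)) := by
          rw [← pow_succ', Fin.val_castSucc]
          congr 1
          omega
        have h2 : r ^ (L + 2 - 1) - r ^ (l : ℕ) =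
            r ^ L * (r - 1) + (r ^ (L + 1 - 1) - r ^ (l : ℕ)) := by
          have := Nat.pow_le_pow_right hr (Nat.lt_succ_iff.mp l.2)
          obtain ⟨s, rfl⟩ := Nat.exists_eq_add_of_lt hr
          simp only [Nat.add_sub_cancel, zero_add] at this ⊢
          simp only [show L + 2 - 1 = L + 1 from rfl, pow_succ, Nat.mul_add] at this ⊢
          omega
        rw [h1, Fin.val_castSucc, h2, pow_add, pow_mul]
        ring
      · refine Finset.sum_congr rfl fun h _ => ?_
        simp [← pow_mul, pow_succ]

end IdentityFilters

/-! ### Coefficients of `Φ` as polynomials in the weights -/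

section Coefficients

variable {K G : Type*} [Field K] [Group G] [Fintype G] {r L : ℕ}

open MvPolynomial

/-- The coefficient of `Φ_θ(g)` at the monomial `x^m`, as a polynomial in the weights `θ`. -/
def symCoeff (K : Type*) {G : Type*} [Field K] [Group G] [Fintype G] (r L : ℕ) (g : G)
    (m : G →₀ ℕ) : MvPolynomial (Fin L × G) K :=
  coeff m (sumAlgEquiv K G (Fin L × G) (symbolicPhi K r L g))

omit [Group G] [Fintype G] in
theorem aeval_specialize_eq_map (θ : Fin L → G → K) (p : MvPolynomial (G ⊕ (Fin L × G)) K) :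
    aeval (specialize θ) p =
      map (eval fun i => θ i.1 i.2) (sumAlgEquiv K G (Fin L × G) p) := by
  induction p using MvPolynomial.induction_on with
  | C a => simp [algebraMap_eq]
  | add p q hp hq => simp only [map_add, hp, hq]
  | mul_X p k hp =>
    rw [map_mul, map_mul, map_mul, hp]
    cases k <;> simp [specialize]

omit [Group G] [Fintype G] in
theorem coeff_sumAlgEquiv_pderiv (m : G →₀ ℕ) (j : Fin L × G)
    (p : MvPolynomial (G ⊕ (Fin L × G)) K) :
    coeff m (sumAlgEquiv K G (Fin L × G) (pderiv (Sum.inr j) p)) =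
      pderiv j (coeff m (sumAlgEquiv K G (Fin L × G) p)) := by
  classical
  induction p using MvPolynomial.induction_on generalizing m with
  | C a => simp [coeff_C, apply_ite]
  | add p q hp hq => simp only [map_add, coeff_add, hp, hq]
  | mul_X p k hp =>
    cases k with
    | inl k =>
      rw [Derivation.leibniz, pderiv_X_of_ne (by simp), smul_zero, zero_add, smul_eq_mul, mul_comm,
        map_mul, map_mul, sumAlgEquiv_X_inl, coeff_mul_X', coeff_mul_X', hp]
      split_ifs <;> simp
    | inr k =>
      rw [mul_comm]
      simp only [Derivation.leibniz, pderiv_X, smul_eq_mul, map_add, map_mul, coeff_add,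
        sumAlgEquiv_X_inr, coeff_C_mul, hp]
      rcases eq_or_ne k j with rfl | hk
      · simp
      · simp [hk]

theorem eval_symCoeff (θ : Fin L → G → K) (g : G) (m : G →₀ ℕ) :
    eval (fun i => θ i.1 i.2) (symCoeff K r L g m) = coeff m (Phi r L θ g).1 := by
  rw [← aeval_symbolicPhi, aeval_specialize_eq_map, coeff_map, symCoeff]

theorem eval_pderiv_symCoeff (θ : Fin L → G → K) (g : G) (m : G →₀ ℕ) (j : Fin L × G) :
    eval (fun i => θ i.1 i.2) (pderiv j (symCoeff K r L g m)) =
      coeff m (partialPhi r L θ j g).1 := by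
  rw [symCoeff, ← coeff_sumAlgEquiv_pderiv, ← coeff_map, ← aeval_specialize_eq_map]
  rfl

/-! ### A nonvanishing minor of the Jacobian -/

/-- The exponent of `x_1^{r^{L-1} - r^l} x_{h⁻¹}^{r^l}`, for `i = (l, h)`. -/
def testExponent (r : ℕ) {L : ℕ} {G : Type*} [Group G] (i : Fin L × G) : G →₀ ℕ :=
  Finsupp.single 1 (r ^ (L - 1) - r ^ (i.1 : ℕ)) + Finsupp.single i.2⁻¹ (r ^ (i.1 : ℕ))

/-- The weights that remain when the filters of all layers but the last are normalized by
`θ_l(1) = 1`. -/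
def FreeWeight (L : ℕ) (G : Type*) [Group G] : Type _ :=
  {i : Fin L × G // i.2 ≠ 1 ∨ (i.1 : ℕ) + 1 = L}

instance : DecidableEq (FreeWeight L G) := Classical.decEq _

open Classical in
instance : Fintype (FreeWeight L G) :=
  inferInstanceAs (Fintype {i : Fin L × G // i.2 ≠ 1 ∨ (i.1 : ℕ) + 1 = L})

theorem card_freeWeight (hL : 1 ≤ L) :
    Fintype.card (FreeWeight L G) = L * (Fintype.card G - 1) + 1 := by
  classical
  obtain ⟨L, rfl⟩ := Nat.exists_eq_add_of_le' hL
  -- The discarded weights are the `θ_l(1)` of the non-final layers; after the shift of `L` there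
  -- are `L` of them.
  have hc : Fintype.card {i : Fin (L + 1) × G // ¬(i.2 ≠ 1 ∨ (i.1 : ℕ) + 1 = L + 1)} = L := by
    refine (Fintype.card_congr (Equiv.ofBijective (fun l : Fin L =>
      (⟨(l.castSucc, 1), by simpa using l.2.ne⟩ :
        {i : Fin (L + 1) × G // ¬(i.2 ≠ 1 ∨ (i.1 : ℕ) + 1 = L + 1)}))
      ⟨fun a b h => ?_, ?_⟩)).symm.trans (Fintype.card_fin L)
    · simpa using h
    · rintro ⟨⟨l, h⟩, hi⟩
      simp only [ne_eq, not_or, not_not] at hi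
      obtain ⟨rfl, hl⟩ := hi
      exact ⟨⟨l, by have := l.2; omega⟩, rfl⟩
  have h : Fintype.card (FreeWeight (L + 1) G) + _ = _ := (Fintype.card_sum).symm.trans
    (Fintype.card_congr (Equiv.sumCompl fun i : Fin (L + 1) × G =>
      i.2 ≠ 1 ∨ (i.1 : ℕ) + 1 = L + 1))
  rw [hc, Fintype.card_prod, Fintype.card_fin] at h
  obtain ⟨n, hn⟩ := Nat.exists_eq_add_of_le' (Fintype.card_pos : 1 ≤ Fintype.card G)
  rw [hn, Nat.mul_add] at h
  rw [hn, Nat.add_sub_cancel]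
  omega

omit [Fintype G] in
-- For `h ≠ 1` the position `h⁻¹` reveals `h`, and its exponent `r^l` reveals `l`. For `h = 1` every
-- layer gives `x_1^(r^(L-1))`, which is why `FreeWeight` keeps only one such index.
theorem testExponent_injective (hr : 2 ≤ r) :
    Function.Injective fun i : FreeWeight L G => testExponent r i.1 := by
  classical
  have key : ∀ i j : Fin L × G, i.2 ≠ 1 → testExponent r i = testExponent r j → i = j := by
    intro i j hi h
    have h' := DFunLike.congr_fun h i.2⁻¹
    have hi' : (1 : G) ≠ i.2⁻¹ := fun e => hi (inv_eq_one.mp e.symm)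
    simp only [testExponent, Finsupp.add_apply, Finsupp.single_apply, inv_inj, hi', if_false,
      if_true, zero_add] at h'
    split_ifs at h' with hj
    · exact Prod.ext (Fin.ext (Nat.pow_right_injective hr h')) hj.symm
    · exact absurd h' (by positivity)
  rintro ⟨i, hi⟩ ⟨j, hj⟩ h
  refine Subtype.ext ?_
  by_cases hi1 : i.2 = 1
  · by_cases hj1 : j.2 = 1
    · have h1 := hi.resolve_left (not_not.mpr hi1)
      have h2 := hj.resolve_left (not_not.mpr hj1)
      exact Prod.ext (Fin.ext (Nat.succ_injective (h1.trans h2.symm))) (hi1.trans hj1.symm)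
    · exact (key j i hj1 h.symm).symm
  · exact key i j hi1 h

theorem partialPhi_single_one [DecidableEq G] (hr : 0 < r) (i : Fin L × G) :
    (partialPhi r L (fun _ => (Pi.single 1 1 : G → K)) i 1).1 =
      monomial (testExponent r i) ((r : K) ^ (L - 1 - i.1)) := by
  have := map_derivation_network (pderiv (R := K) (Sum.inr i : G ⊕ (Fin L × G)))
    (aeval (R := K) (specialize fun _ => (Pi.single 1 1 : G → K))).toRingHom hr
    (fun h => X (Sum.inl h)) (fun g => pderiv_X_of_ne (by simp)) L
    (fun l h => X (Sum.inr (l, h)))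
    (fun l h => by simp [specialize, Pi.single_apply, apply_ite]) 1
  refine this.trans ?_
  rw [← Fintype.sum_prod_type', Finset.sum_eq_single i]
  · have hm : ∀ (a b : G) (m n : ℕ) (c : K),
        monomial (Finsupp.single a m + Finsupp.single b n) c = C c * X a ^ m * X b ^ n := by
      intro a b m n c
      rw [X_pow_eq_monomial, X_pow_eq_monomial, C_mul_monomial, monomial_mul, mul_one, mul_one]
    rw [testExponent, hm]
    simp [specialize]
  · intro j _ hj
    rw [pderiv_X_of_ne (by simpa using hj)]
    simp
  · simp

/-- A square submatrix of the Jacobian matrix of `Φ`, with polynomial entries. -/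
def testMatrix (K G : Type*) [Field K] [Group G] [Fintype G] (r L : ℕ) :
    Matrix (FreeWeight L G) (FreeWeight L G) (MvPolynomial (Fin L × G) K) :=
  Matrix.of fun i j => pderiv j.1 (symCoeff K r L 1 (testExponent r i.1))

theorem eval_det_testMatrix (θ : Fin L → G → K) :
    eval (fun i => θ i.1 i.2) (testMatrix K G r L).det =
      (Matrix.of fun i j : FreeWeight L G =>
        coeff (testExponent r i.1) (partialPhi r L θ j.1 1).1).det := by
  rw [RingHom.map_det]
  congr 1
  ext i j
  simp [testMatrix, eval_pderiv_symCoeff]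

/-- Each column is one monomial and the monomials are distinct, so the matrix is diagonal. -/
theorem eval_det_testMatrix_single_one [DecidableEq G] [CharZero K] (hr : 2 ≤ r) :
    eval (fun i => (Pi.single 1 1 : G → K) i.2) (testMatrix K G r L).det ≠ 0 := by
  have h := eval_det_testMatrix (r := r) (fun _ : Fin L => (Pi.single 1 1 : G → K))
  have hr0 : (r : K) ≠ 0 := Nat.cast_ne_zero.mpr (by omega)
  rw [h, show (Matrix.of fun i j : FreeWeight L G => coeff (testExponent r i.1)
    (partialPhi r L (fun _ => (Pi.single 1 1 : G → K)) j.1 1).1) =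
      Matrix.diagonal fun i : FreeWeight L G => (r : K) ^ (L - 1 - (i.1.1 : ℕ)) from ?_]
  · rw [Matrix.det_diagonal]
    exact Finset.prod_ne_zero_iff.mpr fun i _ => pow_ne_zero _ hr0
  · ext i j
    rw [Matrix.of_apply, partialPhi_single_one (by omega), coeff_monomial, Matrix.diagonal_apply,
      if_congr ((testExponent_injective hr).eq_iff (a := j) (b := i)) rfl rfl]
    by_cases hij : i = j
    · simp [hij]
    · simp [hij, Ne.symm hij]

theorem det_testMatrix_ne_zero [CharZero K] (hr : 2 ≤ r) : (testMatrix K G r L).det ≠ 0 := by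
  classical
  exact fun h => eval_det_testMatrix_single_one (K := K) (G := G) (L := L) hr (by rw [h, map_zero])

/-- The coefficient of `w(1)` at `x^m`, as a linear form on filters `w`. -/
def coeffForm (K : Type*) {G : Type*} [Field K] [Group G] [Fintype G] (d : ℕ) (m : G →₀ ℕ) :
    Module.Dual K (SymFilter K G d) :=
  (lcoeff K m ∘ₗ (homogeneousSubmodule G K d).subtype) ∘ₗ LinearMap.proj 1

@[simp]
theorem coeffForm_apply (d : ℕ) (m : G →₀ ℕ) (w : SymFilter K G d) :
    coeffForm K d m w = coeff m (w 1).1 := rfl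

/-- The coefficient forms send these vectors to the columns of the minor, and independence of images
implies independence. -/
theorem linearIndependent_partialPhi (θ : Fin L → G → K)
    (h : eval (fun i => θ i.1 i.2) (testMatrix K G r L).det ≠ 0) :
    LinearIndependent K fun j : FreeWeight L G => partialPhi r L θ j.1 := by
  rw [eval_det_testMatrix] at h
  exact LinearIndependent.of_comp
    (LinearMap.pi fun i : FreeWeight L G => coeffForm K (r ^ (L - 1)) (testExponent r i.1))
    (Matrix.linearIndependent_cols_of_det_ne_zero h)

/-! ### General regularity -/

/-- Transfers independence of the columns from `θ` to the representatives chosen by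
`Projectivization.rep`. If `s` substitutes `a_l θ_l` for `θ_l`, then `s` multiplies `Φ` by some `c`,
while `∂_i ∘ s = a_i • s ∘ ∂_i`; this gives the factor `c / a_i`. -/
theorem partialPhi_smul (r : ℕ) (a : Fin L → K) (ha : ∀ l, a l ≠ 0) (θ : Fin L → G → K) :
    ∃ u : Fin L × G → Kˣ, ∀ i,
      partialPhi r L (fun l => a l • θ l) i = u i • partialPhi r L θ i := by
  classical
  obtain ⟨c, hc, h⟩ := network_smul (K := K) r L a
    (fun l h => (X (Sum.inr (l, h)) : MvPolynomial (G ⊕ (Fin L × G)) K))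
    (fun h => X (Sum.inl h)) ha
  let s : MvPolynomial (G ⊕ (Fin L × G)) K →ₐ[K] MvPolynomial (G ⊕ (Fin L × G)) K :=
    aeval (Sum.elim (fun h => X (Sum.inl h)) fun i => a i.1 • X (Sum.inr i))
  have hs : ∀ g, s (symbolicPhi K r L g) = c • symbolicPhi K r L g := fun g => by
    have := network_map s.toRingHom r L
      (fun l h => (X (Sum.inr (l, h)) : MvPolynomial (G ⊕ (Fin L × G)) K))
      (fun h => X (Sum.inl h)) g
    refine this.trans (Eq.trans ?_ (h g))
    simp [s]
  have hd : ∀ i p, pderiv (Sum.inr i) (s p) = a i.1 • s (pderiv (Sum.inr i) p) := by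
    intro i p
    induction p using MvPolynomial.induction_on with
    | C b => simp [s, algebraMap_eq]
    | add p q hp hq => simp only [map_add, hp, hq, smul_add]
    | mul_X p k hp =>
      rw [map_mul, Derivation.leibniz, Derivation.leibniz, hp, map_add, smul_eq_mul, smul_eq_mul,
        smul_eq_mul, smul_eq_mul, map_mul, map_mul, smul_add, mul_smul_comm]
      congr 1
      cases k with
      | inl k => simp [s, pderiv_X]
      | inr k =>
        rcases eq_or_ne k i with rfl | hk
        · simp [s]
        · simp [s, hk, pderiv_X]
  have he : ∀ p, aeval (specialize θ) (s p) = aeval (specialize fun l => a l • θ l) p := by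
    intro p
    rw [← AlgHom.comp_apply]
    congr 1
    refine MvPolynomial.algHom_ext fun k => ?_
    cases k <;> simp [s, specialize, smul_eq_C_mul]
  refine ⟨fun i => (Units.mk0 (a i.1) (ha _))⁻¹ * Units.mk0 c hc, fun i => ?_⟩
  rw [mul_smul, eq_inv_smul_iff]
  refine funext fun g => Subtype.ext ?_
  change a i.1 • aeval (specialize fun l => a l • θ l) (pderiv (Sum.inr i) (symbolicPhi K r L g)) =
    c • aeval (specialize θ) (pderiv (Sum.inr i) (symbolicPhi K r L g))
  rw [← he, ← map_smul, ← hd, hs, Derivation.map_smul, map_smul]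

theorem partialPhi_mem_range (θ : Fin L → G → K) (i : Fin L × G) :
    partialPhi r L θ i ∈ LinearMap.range (jacobianPhi r L θ) := by
  classical
  refine ⟨fun l h => if (l, h) = i then 1 else 0, ?_⟩
  simp [jacobianPhi]

/-- Rank-nullity for the quotient map restricted to the range of `f`: its kernel embeds in `P`. -/
theorem finrank_range_le_finrank_range_mkQ_add {V W : Type*} [AddCommGroup V] [Module K V]
    [Module.Finite K V] [AddCommGroup W] [Module K W] (f : V →ₗ[K] W) (P : Submodule K W)
    [Module.Finite K P] :
    Module.finrank K (LinearMap.range f) ≤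
      Module.finrank K (LinearMap.range (P.mkQ ∘ₗ f)) + Module.finrank K P := by
  let π := P.mkQ.domRestrict (LinearMap.range f)
  rw [← LinearMap.finrank_range_add_finrank_ker π]
  refine add_le_add (Submodule.finrank_mono ?_) ?_
  · rintro _ ⟨⟨_, v, rfl⟩, rfl⟩
    exact ⟨v, rfl⟩
  · let ι : LinearMap.ker π →ₗ[K] W := (LinearMap.range f).subtype ∘ₗ (LinearMap.ker π).subtype
    have hι : Function.Injective ι :=
      (LinearMap.range f).injective_subtype.comp (LinearMap.ker π).injective_subtype
    exact LinearMap.finrank_le_finrank_of_injective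
      (f := ι.codRestrict P fun x => (Submodule.Quotient.mk_eq_zero _).mp x.2)
      (by rwa [← LinearMap.ker_eq_bot, LinearMap.ker_codRestrict, LinearMap.ker_eq_bot])

theorem finrank_range_jacobianPhi_le (p : Fin L → ℙ K (G → K))
    (hp : Phi r L (fun l => (p l).rep) ≠ 0) :
    Module.finrank K (LinearMap.range (jacobianPhi r L fun l => (p l).rep)) ≤
      Module.finrank K (LinearMap.range (jacobianPhiTilde r L p hp)) + 1 := by
  have : Module.Finite K (PhiTilde r L p hp).submodule := by
    rw [Projectivization.submodule_eq]
    exact Module.Finite.span_singleton K _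
  have h := finrank_range_le_finrank_range_mkQ_add (jacobianPhi r L fun l => (p l).rep)
    (PhiTilde r L p hp).submodule
  rw [Projectivization.finrank_submodule] at h
  refine h.trans (Nat.add_le_add_right (Submodule.finrank_mono ?_) 1)
  rintro _ ⟨v, rfl⟩
  exact ⟨Submodule.Quotient.mk v, rfl⟩

theorem isGenerallyRegular [CharZero K] (hr : 2 ≤ r) (hL : 1 ≤ L) :
    IsGenerallyRegular K G r L := by
  classical
  -- At the identity filters the coefficient of `x_1^(r^(L-1))` in `Φ(1)` is `1`. As a factor of the
  -- excluded polynomial it guarantees `Φ_θ ≠ 0`.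
  let m : G →₀ ℕ := Finsupp.single 1 (r ^ (L - 1))
  have hm : symCoeff K r L (1 : G) m ≠ 0 := fun h => by
    have := eval_symCoeff (r := r) (fun _ : Fin L => (Pi.single 1 1 : G → K)) 1 m
    have h' : (Phi r L (fun _ => (Pi.single 1 1 : G → K)) 1).1 = X 1 ^ r ^ (L - 1) := by
      refine Eq.trans ?_ (network_single_one r L (X : G → MvPolynomial G K) 1)
      change network _ _ _ _ _ = _
      congr 1
      funext l g
      simp [Pi.single_apply, apply_ite]
    rw [h, map_zero, h', X_pow_eq_monomial, coeff_monomial, if_pos rfl] at this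
    exact zero_ne_one this
  refine ⟨symCoeff K r L (1 : G) m * (testMatrix K G r L).det,
    mul_ne_zero hm (det_testMatrix_ne_zero hr), fun θ hθ h => ?_⟩
  rw [map_mul, mul_ne_zero_iff, eval_symCoeff] at h
  choose a ha using fun l => Projectivization.exists_smul_eq_mk_rep K (θ l) (hθ l)
  have ha' : (fun l => (Projectivization.mk K (θ l) (hθ l)).rep) = fun l => (a l : K) • θ l :=
    funext fun l => (ha l).symm
  obtain ⟨c, hc, e⟩ := Phi_smul r L (fun l => (a l : K)) (fun l => (a l).ne_zero) θ
  have hp : Phi r L (fun l => (Projectivization.mk K (θ l) (hθ l)).rep) ≠ 0 := by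
    rw [ha', e]
    refine smul_ne_zero hc fun h0 => h.1 ?_
    rw [h0]
    simp
  refine ⟨hp, le_antisymm (LinearMap.finrank_range_le _) ?_⟩
  obtain ⟨u, hu⟩ := partialPhi_smul r (fun l => (a l : K)) (fun l => (a l).ne_zero) θ
  have hli : LinearIndependent K fun j : FreeWeight L G =>
      partialPhi r L (fun l => (Projectivization.mk K (θ l) (hθ l)).rep) j.1 := by
    rw [ha']
    simp only [hu]
    exact (linearIndependent_partialPhi θ h.2).units_smul fun j => u j.1
  have h1 := finrank_range_jacobianPhi_le _ hp
  have h2 := (finrank_span_eq_card hli).symm.trans_le (Submodule.finrank_mono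
    (Submodule.span_le.mpr (Set.range_subset_iff.mpr fun j => partialPhi_mem_range _ j.1)))
  rw [card_freeWeight hL] at h2
  rw [finrank_sourceTangent]
  omega

/-! ### The coordinate ring of the neuromanifold -/

instance finiteType_coordinateRing (K : Type*) {W : Type*} [Field K] [AddCommGroup W]
    [Module K W] [Module.Finite K W] (S : Set W) : Algebra.FiniteType K (coordinateRing K S) := by
  let e : Module.Dual K W →ₗ[K] (S → K) :=
    { toFun := fun ℓ s => ℓ (s : W)
      map_add' := fun _ _ => rfl
      map_smul' := fun _ _ => rfl }
  obtain ⟨t, ht⟩ := Module.Finite.iff_fg.mp (inferInstance : Module.Finite K (LinearMap.range e))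
  refine (Subalgebra.fg_iff_finiteType _).mp ⟨t, ?_⟩
  rw [← Algebra.adjoin_span, ht]
  rfl

/-- The evaluation of polynomials at the points of affine space. -/
def evalHom (K τ : Type*) [Field K] : MvPolynomial τ K →ₐ[K] ((τ → K) → K) :=
  AlgHom.pi fun x => aeval x

theorem evalHom_injective (K τ : Type*) [Field K] [Infinite K] :
    Function.Injective (evalHom K τ) := fun p q h =>
  MvPolynomial.funext fun x => by simpa [evalHom, aeval_eq_eval] using congrFun h x

instance finite_symFilter (d : ℕ) : Module.Finite K (SymFilter K G d) := by
  have : Module.Finite K (homogeneousSubmodule G K d) :=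
    Module.Finite.iff_fg.mpr (homogeneousSubmodule_fg G K d)
  infer_instance

theorem exists_eval_eq_dual_Phi (ℓ : Module.Dual K (SymFilter K G (r ^ (L - 1)))) :
    ∃ p : MvPolynomial (Fin L × G) K, ∀ θ, ℓ (Phi r L θ) = eval (fun i => θ i.1 i.2) p := by
  classical
  let incl : SymFilter K G (r ^ (L - 1)) →ₗ[K] (G → MvPolynomial G K) :=
    (homogeneousSubmodule G K (r ^ (L - 1))).subtype.compLeft G
  have hincl : LinearMap.ker incl = ⊥ := LinearMap.ker_eq_bot.mpr fun v w h =>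
    funext fun g => Subtype.ext (congrFun h g)
  -- The retraction `s` extends `ℓ` to all polynomial filters, so `Φ_θ` can be expanded in monomials
  -- without tracking their degrees.
  obtain ⟨s, hs⟩ := incl.exists_leftInverse_of_injective hincl
  refine ⟨∑ g, ∑ m ∈ (sumAlgEquiv K G (Fin L × G) (symbolicPhi K r L g)).support,
    symCoeff K r L g m * C (ℓ (s (Pi.single g (monomial m 1)))), fun θ => ?_⟩
  have h1 : incl (Phi r L θ) = ∑ g,
      ∑ m ∈ (sumAlgEquiv K G (Fin L × G) (symbolicPhi K r L g)).support,
        eval (fun i => θ i.1 i.2) (symCoeff K r L g m) •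
        Pi.single g (monomial m 1) := by
    funext g
    change (Phi r L θ g).1 = _
    rw [← aeval_symbolicPhi, aeval_specialize_eq_map, Finset.sum_apply, Finset.sum_eq_single g]
    · conv_lhs => rw [(sumAlgEquiv K G (Fin L × G) (symbolicPhi K r L g)).as_sum, map_sum]
      simp [symCoeff, map_monomial, smul_monomial]
    · intro b _ hb
      simp [hb.symm]
    · simp
  have h2 : Phi r L θ = s (incl (Phi r L θ)) := by rw [← LinearMap.comp_apply, hs]; rfl
  rw [h2, h1]
  simp

theorem exists_eval_eq_of_mem_coordinateRing {ρ : neuromanifold K G r L → K}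
    (hρ : ρ ∈ coordinateRing K (neuromanifold K G r L)) :
    ∃ p : MvPolynomial (Fin L × G) K,
      ∀ θ, ρ ⟨Phi r L θ, θ, rfl⟩ = eval (fun i => θ i.1 i.2) p := by
  induction hρ using Algebra.adjoin_induction with
  | mem x hx =>
    obtain ⟨ℓ, rfl⟩ := hx
    exact exists_eval_eq_dual_Phi ℓ
  | algebraMap c => exact ⟨C c, fun θ => by simp⟩
  | add x y _ _ hx hy =>
    obtain ⟨p, hp⟩ := hx
    obtain ⟨q, hq⟩ := hy
    exact ⟨p + q, fun θ => by simp [hp, hq]⟩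
  | mul x y _ _ hx hy =>
    obtain ⟨p, hp⟩ := hx
    obtain ⟨q, hq⟩ := hy
    exact ⟨p * q, fun θ => by simp [hp, hq]⟩

/-- Polynomial functions on the neuromanifold, pulled back along `Φ`. -/
theorem exists_pullback [Infinite K] (r L : ℕ) :
    ∃ Ψ : coordinateRing K (neuromanifold K G r L) →ₐ[K] MvPolynomial (Fin L × G) K,
      ∀ ρ θ, eval (fun i => θ i.1 i.2) (Ψ ρ) = ρ.1 ⟨Phi r L θ, θ, rfl⟩ := by
  let pull : (neuromanifold K G r L → K) →ₐ[K] ((Fin L × G → K) → K) :=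
    AlgHom.pi fun y => Pi.evalAlgHom K (fun _ => K) ⟨Phi r L (Function.curry y), _, rfl⟩
  -- The pullback lands in the polynomial functions, which are identified with polynomials because
  -- `K` is infinite.
  let Ψ₀ : coordinateRing K (neuromanifold K G r L) →ₐ[K] (evalHom K (Fin L × G)).range :=
    (pull.comp (coordinateRing K (neuromanifold K G r L)).val).codRestrict _ fun ρ => by
      obtain ⟨p, hp⟩ := exists_eval_eq_of_mem_coordinateRing ρ.2
      refine ⟨p, funext fun y => ?_⟩
      simpa [pull, evalHom, aeval_eq_eval] using (hp (Function.curry y)).symm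
  refine ⟨((AlgEquiv.ofInjective _ (evalHom_injective K (Fin L × G))).symm : _ →ₐ[K] _).comp Ψ₀,
    fun ρ θ => ?_⟩
  have h := congrArg Subtype.val ((AlgEquiv.ofInjective _
    (evalHom_injective K (Fin L × G))).apply_symm_apply (Ψ₀ ρ))
  exact congrFun h fun i => θ i.1 i.2

/-! ### Normalizing the filters by rescaling -/

/-- No activation follows the last layer, so the network is linear in the last filter. -/
theorem network_update_last {A : Type*} [CommSemiring A] (r : ℕ) (c : A) :
    ∀ (L : ℕ) (θ : Fin (L + 1) → G → A) (x : G → A),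
      network r (L + 1) (Function.update θ (Fin.last L) (c • θ (Fin.last L))) x =
        c • network r (L + 1) θ x
  | 0, θ, x => by
    funext g
    simp [network, conv, Finset.mul_sum, mul_left_comm]
  | L + 1, θ, x => by
    funext g
    have h : ∀ l : Fin (L + 1), l.castSucc ≠ Fin.last (L + 1) := fun l => l.castSucc_lt_last.ne
    simp [network, conv, Finset.mul_sum, mul_left_comm, h]

theorem Phi_update_last (r : ℕ) (c : K) (θ : Fin (L + 1) → G → K) :
    Phi r (L + 1) (Function.update θ (Fin.last L) (c • θ (Fin.last L))) =
      c • Phi r (L + 1) θ := by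
  refine funext fun g => Subtype.ext ?_
  have h := congrFun (network_update_last r (C c : MvPolynomial G K) L
    (fun l h => C (θ l h)) X) g
  change network _ _ _ _ _ = c • network _ _ _ _ _
  rw [smul_eq_C_mul]
  refine Eq.trans ?_ h
  congr 1
  funext l h
  rcases eq_or_ne l (Fin.last L) with rfl | hl
  · simp
  · simp [hl]

/-- Extend free weights by the normalization `θ_l(1) = 1` to all weights. -/
def normalForm {A : Type*} [One A] (t : FreeWeight L G → A) (i : Fin L × G) : A :=
  open Classical in if h : i.2 ≠ 1 ∨ (i.1 : ℕ) + 1 = L then t ⟨i, h⟩ else 1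

omit [Fintype G] in
theorem eval_aeval_normalForm (t : FreeWeight L G → K) (p : MvPolynomial (Fin L × G) K) :
    eval t (aeval (normalForm X) p) = eval (normalForm t) p := by
  have h : ∀ i : Fin L × G, eval t (normalForm X i) = normalForm t i := fun i => by
    unfold normalForm
    split_ifs with h
    · exact eval_X _
    · exact map_one _
  induction p using MvPolynomial.induction_on with
  | C a => simp [algebraMap_eq]
  | add p q hp hq => simp only [map_add, hp, hq]
  | mul_X p k hp => rw [map_mul, map_mul, map_mul, hp, aeval_X, h, eval_X]

/-- Dividing each filter by `θ_l(1)` multiplies `Φ` by some `c ≠ 0`. The last filter absorbs `c⁻¹`,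
since its value at `1` stays free. -/
theorem exists_Phi_normalForm_eq (θ : Fin L → G → K) (hθ : ∀ l, θ l 1 ≠ 0) :
    ∃ t, Phi r L (Function.curry (normalForm t)) = Phi r L θ := by
  classical
  have hnf : ∀ θ' : Fin L → G → K, (∀ l : Fin L, (l : ℕ) + 1 ≠ L → θ' l 1 = 1) →
      Function.curry (normalForm fun i => θ' i.1.1 i.1.2) = θ' := by
    intro θ' h
    funext l g
    simp only [Function.curry, normalForm]
    split_ifs with hi
    · rfl
    · simp only [ne_eq, not_or, not_not] at hi
      rw [hi.1, h l hi.2]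
  cases L with
  | zero => exact ⟨fun i => i.1.1.elim0, congrArg _ (Subsingleton.elim _ _)⟩
  | succ L =>
    obtain ⟨c, hc, e⟩ := Phi_smul r (L + 1) (fun l => (θ l 1)⁻¹) (fun l => inv_ne_zero (hθ l)) θ
    let θ' : Fin (L + 1) → G → K := fun l => (θ l 1)⁻¹ • θ l
    refine ⟨_, (congrArg (Phi r (L + 1)) (hnf (Function.update θ' (Fin.last L)
      (c⁻¹ • θ' (Fin.last L))) fun l hl => ?_)).trans ?_⟩
    · have : l ≠ Fin.last L := fun h => hl (by simp [h])
      simp [this, θ', hθ]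
    · rw [Phi_update_last, e, inv_smul_smul₀ hc]

/-! ### Dimension of the neuromanifold -/

theorem zariskiDim_neuromanifold [CharZero K] (hr : 2 ≤ r) (hL : 1 ≤ L) :
    zariskiDim K (neuromanifold K G r L) =
      ((L * (Fintype.card G - 1) + 1 : ℕ) : WithBot ℕ∞) := by
  classical
  obtain ⟨Ψ, hΨ⟩ := exists_pullback (K := K) (G := G) r L
  let F : FreeWeight L G → coordinateRing K (neuromanifold K G r L) := fun i =>
    ⟨fun w => coeffForm K (r ^ (L - 1)) (testExponent r i.1) w.1,
      Algebra.subset_adjoin ⟨coeffForm K (r ^ (L - 1)) (testExponent r i.1), rfl⟩⟩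
  -- Lower bound: the pullbacks of these coordinates have `testMatrix` as a Jacobian submatrix.
  have hF : AlgebraicIndependent K F := by
    refine AlgebraicIndependent.of_comp Ψ ?_
    have h : Ψ ∘ F = fun i => symCoeff K r L 1 (testExponent r i.1) := by
      refine funext fun i => MvPolynomial.funext fun y => ?_
      refine (hΨ (F i) (Function.curry y)).trans ?_
      exact (eval_symCoeff (Function.curry y) 1 _).symm
    rw [h]
    exact algebraicIndependent_of_det_pderiv_ne_zero _ (fun i => i.1) (det_testMatrix_ne_zero hr)
  rw [zariskiDim, ← card_freeWeight hL]
  refine ringKrullDim_eq_of_algebraicIndependent_of_injective (κ := FreeWeight L G) rfl hF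
    ((aeval (normalForm X)).comp Ψ) ((injective_iff_map_eq_zero _).mpr fun ρ hρ => ?_)
  -- Normalization is available only where all `θ_l(1)` are nonzero; the product vanishes elsewhere
  -- and cancels afterwards.
  have h0 : Ψ ρ * ∏ l, X (l, 1) = 0 := by
    refine MvPolynomial.funext fun y => ?_
    rw [map_mul, map_prod, map_zero]
    by_cases hy : ∀ l, y (l, 1) ≠ 0
    · obtain ⟨t, ht⟩ := exists_Phi_normalForm_eq (r := r) (Function.curry y) hy
      have h1 : eval (fun i => Function.curry y i.1 i.2) (Ψ ρ) = 0 := by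
        rw [hΨ]
        simp only [← ht]
        rw [← hΨ]
        refine (eval_aeval_normalForm t (Ψ ρ)).symm.trans ?_
        rw [← AlgHom.comp_apply, hρ, map_zero]
      exact mul_eq_zero_of_left h1 _
    · push Not at hy
      obtain ⟨l, hl⟩ := hy
      exact mul_eq_zero_of_right _ (Finset.prod_eq_zero (Finset.mem_univ l) (by simpa using hl))
  have hΨ0 : Ψ ρ = 0 := (mul_eq_zero.mp h0).resolve_right
    (Finset.prod_ne_zero_iff.mpr fun l _ => X_ne_zero _)
  -- Every point of the neuromanifold is some `Φ_θ`, so `ρ` is determined by its pullback.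
  refine Subtype.ext (funext ?_)
  rintro ⟨_, θ, rfl⟩
  rw [← hΨ, hΨ0]
  simp

end Coefficients

end PGCNN

end

theorem mainTheorem2 {K G : Type*} [Field K] [CharZero K] [Group G] [Fintype G]
    (r L : ℕ) (hr : 2 ≤ r) (hL : 1 ≤ L) :
    PGCNN.IsGenerallyRegular K G r L ∧
      PGCNN.zariskiDim K (PGCNN.neuromanifold K G r L) =
        ((L * (Fintype.card G - 1) + 1 : ℕ) : WithBot ℕ∞) :=
  ⟨PGCNN.isGenerallyRegular hr hL, PGCNN.zariskiDim_neuromanifold hr hL⟩
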